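/- Let $I=[0,1]$; "increasing" means non-decreasing and "decreasing" means non-increasing. A copula is a function $C\colon I^2\to I$ with $C(x,0)=C(0,x)=0$ and $C(x,1)=C(1,x)=x$ for all $x\in I$, and $C(b,d)+C(a,c)-C(b,c)-C(a,d)\ge 0$ whenever $a\le b$ and $c\le d$ in $I$. A quasi-copula satisfies the same boundary conditions and is increasing in each variable and $1$-Lipschitz, $|Q(x_1,y_1)-Q(x_2,y_2)|\le|x_1-x_2|+|y_1-y_2|$. A diagonal section is a function $\delta\colon I\to I$ of the form $\delta(x)=\delta_Q(x):=Q(x,x)$ for some copula or quasi-copula $Q$. Put $\widehat\delta(x)=x-\delta(x)$, and call $\delta$ simple if there is $t_0\in I$ such that $\widehat\delta$ is increasing on $[0,t_0]$ and decreasing on $[t_0,1]$. Let $$\mu_\delta=\sup\Big\{\max_{x,y\in I}|C(x,y)-C(y,x)| : C \text{ a copula with } \delta_C=\delta\Big\}.$$ For $x,y\in I$ let $$f^\delta(x,y)=y-\tfrac12\big(\widehat\delta(x)+\widehat\delta(y)+\mathrm{TV}_x^y(\widehat\delta)\big),$$ where $\mathrm{TV}_x^y(\widehat\delta)$ is the total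 variation of $\widehat\delta$ on $[x,y]$ if $x\le y$, and $\mathrm{TV}_x^y=-\mathrm{TV}_y^x$ if $y<x$. Let $D_f(\delta)$ be the union of the closure of $\{(x,y)\in I^2 : f^\delta(x,y)<\min\{x,y\}\}$ and the diagonal $\{(x,x):x\in I\}$, and for $x\in I$ let $$g_U^\delta(x)=\max\{y\in I : (x,y)\in D_f(\delta)\},\qquad h^\delta(x)=\max\{y\in I : y\ge x,\ \widehat\delta(t)\ge\widehat\delta(x)\text{ for all }t\in[x,y]\}.$$ Let $Z_\delta\subseteq I$ be the set of discontinuities of $h^\delta\colon I\to I$, and $$H_\delta=\{(x,h^\delta(x)):x\in I\}\cup\bigcup_{x\in Z_\delta}\{x\}\times\big[\liminf_{t\to x}h^\delta(t),\,h^\delta(x)\big].$$ Proposition. If $\delta$ is a simple diagonal section, then there is a unique point $x_0\in I$ such that $\widehat\delta$ is increasing on $[0,x_0]$ and $(x_0,g_U^\delta(x_0))\in H_\delta$. For this point, $\mu_\delta=\widehat\delta(x_0)=\widehat\delta(g_U^\delta(x_0))$. -/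

import Mathlib

open Set Filter Topology

/-!  Functions on the unit interval `I = [0,1]` (or on `I × I`) are represented by functions on `ℝ`
(or on `ℝ × ℝ`, curried); every definition below only looks at their values on `I`. -/

namespace DiagCopula

/-- `V_C([a,b] × [c,d])`. -/
def rectVolume (C : ℝ → ℝ → ℝ) (a b c d : ℝ) : ℝ :=
  C b d + C a c - C b c - C a d

def MapsToUnit (C : ℝ → ℝ → ℝ) : Prop :=
  ∀ x ∈ Icc (0 : ℝ) 1, ∀ y ∈ Icc (0 : ℝ) 1, C x y ∈ Icc (0 : ℝ) 1

def Grounded (C : ℝ → ℝ → ℝ) : Prop :=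
  ∀ x ∈ Icc (0 : ℝ) 1, C x 0 = 0 ∧ C 0 x = 0

def UniformMarginals (C : ℝ → ℝ → ℝ) : Prop :=
  ∀ x ∈ Icc (0 : ℝ) 1, C x 1 = x ∧ C 1 x = x

def TwoIncreasing (C : ℝ → ℝ → ℝ) : Prop :=
  ∀ a ∈ Icc (0 : ℝ) 1, ∀ b ∈ Icc (0 : ℝ) 1, ∀ c ∈ Icc (0 : ℝ) 1, ∀ d ∈ Icc (0 : ℝ) 1,
    a ≤ b → c ≤ d → 0 ≤ rectVolume C a b c d

/-- A bivariate copula `C : I² → I`. -/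
structure IsCopula (C : ℝ → ℝ → ℝ) : Prop where
  mapsTo : MapsToUnit C
  grounded : Grounded C
  marginals : UniformMarginals C
  twoIncreasing : TwoIncreasing C

/-- A bivariate quasi-copula `Q : I² → I`. -/
structure IsQuasiCopula (Q : ℝ → ℝ → ℝ) : Prop where
  mapsTo : MapsToUnit Q
  grounded : Grounded Q
  marginals : UniformMarginals Q
  mono_left : ∀ y ∈ Icc (0 : ℝ) 1, MonotoneOn (fun x => Q x y) (Icc 0 1)
  mono_right : ∀ x ∈ Icc (0 : ℝ) 1, MonotoneOn (fun y => Q x y) (Icc 0 1)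
  lipschitz : ∀ x₁ ∈ Icc (0 : ℝ) 1, ∀ y₁ ∈ Icc (0 : ℝ) 1,
    ∀ x₂ ∈ Icc (0 : ℝ) 1, ∀ y₂ ∈ Icc (0 : ℝ) 1,
      |Q x₁ y₁ - Q x₂ y₂| ≤ |x₁ - x₂| + |y₁ - y₂|

/-- `δ_C = δ` on `I`. -/
def HasDiagonal (C : ℝ → ℝ → ℝ) (δ : ℝ → ℝ) : Prop :=
  ∀ x ∈ Icc (0 : ℝ) 1, C x x = δ x

/-- `δ` is the diagonal section of a copula or a quasi-copula. -/
def IsDiagonalSection (δ : ℝ → ℝ) : Prop :=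
  ∃ C : ℝ → ℝ → ℝ, (IsCopula C ∨ IsQuasiCopula C) ∧ HasDiagonal C δ

/-- `δ̂(x) = x - δ(x)`. -/
def hat (δ : ℝ → ℝ) (x : ℝ) : ℝ := x - δ x

/-- `δ` is simple: `δ̂` is increasing on `[0,t₀]` and decreasing on `[t₀,1]` for some `t₀ ∈ I`. -/
def IsSimple (δ : ℝ → ℝ) : Prop :=
  ∃ t₀ ∈ Icc (0 : ℝ) 1, MonotoneOn (hat δ) (Icc 0 t₀) ∧ AntitoneOn (hat δ) (Icc t₀ 1)

/-- `μ(C)`, the supremum of `|C(x,y) - C(y,x)|` over `x, y ∈ I`. -/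
noncomputable def asymmetry (C : ℝ → ℝ → ℝ) : ℝ :=
  sSup {r : ℝ | ∃ x ∈ Icc (0 : ℝ) 1, ∃ y ∈ Icc (0 : ℝ) 1, r = |C x y - C y x|}

/-- `μ_δ`, the supremum of `μ(C)` over all copulas `C` with diagonal section `δ`. -/
noncomputable def maxAsymmetry (δ : ℝ → ℝ) : ℝ :=
  sSup {r : ℝ | ∃ C : ℝ → ℝ → ℝ, IsCopula C ∧ HasDiagonal C δ ∧ r = asymmetry C}

/-- `f^δ(x,y) = y - (δ̂(x) + δ̂(y) + TV_x^y(δ̂)) / 2`.  `variationOnFromTo` is the total variation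
on `[x,y]` if `x ≤ y`, and minus the total variation on `[y,x]` otherwise. -/
noncomputable def f (δ : ℝ → ℝ) (x y : ℝ) : ℝ :=
  y - (1 / 2 : ℝ) * (hat δ x + hat δ y + variationOnFromTo (hat δ) (Icc 0 1) x y)

/-- `D_f°(δ)`. -/
def DfOpen (δ : ℝ → ℝ) : Set (ℝ × ℝ) :=
  {p | p.1 ∈ Icc (0 : ℝ) 1 ∧ p.2 ∈ Icc (0 : ℝ) 1 ∧ f δ p.1 p.2 < min p.1 p.2}

/-- `D_f(δ)`: the closure of `D_f°(δ)` together with the main diagonal of `I²`. -/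
def Df (δ : ℝ → ℝ) : Set (ℝ × ℝ) :=
  closure (DfOpen δ) ∪ {p | p.1 ∈ Icc (0 : ℝ) 1 ∧ p.1 = p.2}

/-- `g_U^δ(x) = max {y ∈ I : (x,y) ∈ D_f(δ)}`  (for `x ∈ I` the set is compact and contains `x`). -/
noncomputable def gU (δ : ℝ → ℝ) (x : ℝ) : ℝ :=
  sSup {y : ℝ | y ∈ Icc (0 : ℝ) 1 ∧ (x, y) ∈ Df δ}

/-- `h^δ(x) = max {y ∈ I : y ≥ x, δ̂(t) ≥ δ̂(x) for all t ∈ [x,y]}`  (for `x ∈ I` the set is compact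
and contains `x`). -/
noncomputable def h (δ : ℝ → ℝ) (x : ℝ) : ℝ :=
  sSup {y : ℝ | y ∈ Icc (0 : ℝ) 1 ∧ x ≤ y ∧ ∀ t ∈ Icc x y, hat δ x ≤ hat δ t}

/-- `Z_δ`: the discontinuities in `I` of `h^δ` as a function on `I`. -/
def Z (δ : ℝ → ℝ) : Set ℝ :=
  {x | x ∈ Icc (0 : ℝ) 1 ∧ ¬ ContinuousWithinAt (h δ) (Icc 0 1) x}

/-- `liminf_{t → x} h^δ(t)` over `t ∈ I`, `t ≠ x`. -/
noncomputable def hLiminf (δ : ℝ → ℝ) (x : ℝ) : ℝ :=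
  liminf (h δ) (𝓝[Icc (0 : ℝ) 1 \ {x}] x)

/-- `H_δ`: the graph of `h^δ` with vertical segments added at its discontinuities. -/
def H (δ : ℝ → ℝ) : Set (ℝ × ℝ) :=
  {p | p.1 ∈ Icc (0 : ℝ) 1 ∧ p.2 = h δ p.1} ∪
    ⋃ x ∈ Z δ, ({x} : Set ℝ) ×ˢ Icc (hLiminf δ x) (h δ x)

end DiagCopula

/-! Write `w = hat δ`, let `T` be the largest maximizer of `w`, and put `m = w T`. Because `w` rises
and then falls, its total variation telescopes: `f δ x y = y - m` for `x ≤ T ≤ y`, and `f δ x y ≥ y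
- m` whenever `x ≤ y`. Hence `Df δ` stays below the line `y = x + m` and reaches it over `[T - m,
T]`, where `gU δ x = x + m`. On `[0, T]` the function `h δ` is antitone, and `h δ x` is the last
point at which `w` is at least `w x`. A strictly increasing line meets an antitone graph with filled
jumps only once. The meeting point is the largest `a ∈ [T - m, T]` with `w a ≤ w (a + m)`, and
continuity turns this into an equality (`IsCrossing.eq`, `IsCrossing.mem_H`,
`IsCrossing.eq_of_mem_H`).

Put `b = a + m`. For the upper bound, `IsCopula.sub_swap_le` estimates `C x y - C y x` by the values
of `w` at `x`, `y` and any `t` between them. Monotonicity of `w` settles `x ≤ a` and `b ≤ y`; inside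
`[a, b]` the choice of `t` nearest to `T` and the Lipschitz property suffice.

The bound is attained by `crossingCopula`, a sum of comonotone couplings between pieces of `[0, a]`,
`[a, T]`, `[T, b]`, `[b, 1]`. The equations `b = a + m` and `w a = w b` are what balance the masses
of the pieces. -/

namespace DiagCopula

/-! ### Copulas are quasi-copulas, and properties of `hat δ` -/

theorem unit_zero_mem : (0 : ℝ) ∈ Icc (0 : ℝ) 1 := ⟨le_rfl, zero_le_one⟩

theorem unit_one_mem : (1 : ℝ) ∈ Icc (0 : ℝ) 1 := ⟨zero_le_one, le_rfl⟩

theorem IsCopula.swap {C : ℝ → ℝ → ℝ} (hC : IsCopula C) : IsCopula fun x y => C y x where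
  mapsTo x hx y hy := hC.mapsTo y hy x hx
  grounded x hx := (hC.grounded x hx).symm
  marginals x hx := (hC.marginals x hx).symm
  twoIncreasing a ha b hb c hc d hd hab hcd := by
    have := hC.twoIncreasing c hc d hd a ha b hb hcd hab
    unfold rectVolume at *
    linarith

theorem IsCopula.left_le {C : ℝ → ℝ → ℝ} (hC : IsCopula C) {x x' y : ℝ}
    (hx : x ∈ Icc (0 : ℝ) 1) (hx' : x' ∈ Icc (0 : ℝ) 1) (hy : y ∈ Icc (0 : ℝ) 1) (h : x ≤ x') :
    C x y ≤ C x' y ∧ C x' y ≤ C x y + (x' - x) := by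
  have h1 := hC.twoIncreasing x hx x' hx' 0 unit_zero_mem y hy h hy.1
  have h2 := hC.twoIncreasing x hx x' hx' y hy 1 unit_one_mem h hy.2
  have := (hC.grounded x hx).1
  have := (hC.grounded x' hx').1
  have := (hC.marginals x hx).1
  have := (hC.marginals x' hx').1
  unfold rectVolume at h1 h2
  constructor <;> linarith

theorem IsCopula.right_le {C : ℝ → ℝ → ℝ} (hC : IsCopula C) {x y y' : ℝ}
    (hx : x ∈ Icc (0 : ℝ) 1) (hy : y ∈ Icc (0 : ℝ) 1) (hy' : y' ∈ Icc (0 : ℝ) 1) (h : y ≤ y') :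
    C x y ≤ C x y' ∧ C x y' ≤ C x y + (y' - y) :=
  hC.swap.left_le hy hy' hx h

theorem abs_sub_le_of_step {g : ℝ → ℝ}
    (hg : ∀ x ∈ Icc (0 : ℝ) 1, ∀ x' ∈ Icc (0 : ℝ) 1, x ≤ x' → g x ≤ g x' ∧ g x' ≤ g x + (x' - x))
    {x x' : ℝ} (hx : x ∈ Icc (0 : ℝ) 1) (hx' : x' ∈ Icc (0 : ℝ) 1) : |g x - g x'| ≤ |x - x'| := by
  rcases le_total x x' with h | h
  · have := hg x hx x' hx' h
    rw [abs_of_nonpos (by linarith), abs_of_nonpos (by linarith)]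
    linarith
  · have := hg x' hx' x hx h
    rw [abs_of_nonneg (by linarith), abs_of_nonneg (by linarith)]
    linarith

theorem IsCopula.isQuasiCopula {C : ℝ → ℝ → ℝ} (hC : IsCopula C) : IsQuasiCopula C where
  mapsTo := hC.mapsTo
  grounded := hC.grounded
  marginals := hC.marginals
  mono_left _ hy _ hx _ hx' h := (hC.left_le hx hx' hy h).1
  mono_right _ hx _ hy _ hy' h := (hC.right_le hx hy hy' h).1
  lipschitz x₁ hx₁ y₁ hy₁ x₂ hx₂ y₂ hy₂ := by
    have h1 : |C x₁ y₁ - C x₂ y₁| ≤ |x₁ - x₂| :=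
      abs_sub_le_of_step (g := fun x => C x y₁) (fun _ hx _ hx' h => hC.left_le hx hx' hy₁ h) hx₁ hx₂
    have h2 : |C x₂ y₁ - C x₂ y₂| ≤ |y₁ - y₂| :=
      abs_sub_le_of_step (g := fun y => C x₂ y) (fun _ hy _ hy' h => hC.right_le hx₂ hy hy' h) hy₁ hy₂
    linarith [abs_sub_le (C x₁ y₁) (C x₂ y₁) (C x₂ y₂)]

/-- The properties of `hat δ` for a simple diagonal section `δ`; `T` is the largest point at which
`hat δ` attains its maximum. -/
structure HasPeak (δ : ℝ → ℝ) (T : ℝ) : Prop where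
  nonneg : ∀ x ∈ Icc (0 : ℝ) 1, 0 ≤ hat δ x
  zero : hat δ 0 = 0
  one : hat δ 1 = 0
  lip : ∀ x ∈ Icc (0 : ℝ) 1, ∀ y ∈ Icc (0 : ℝ) 1, x ≤ y →
    hat δ y ≤ hat δ x + (y - x) ∧ hat δ x ≤ hat δ y + (y - x)
  mem : T ∈ Icc (0 : ℝ) 1
  mono : MonotoneOn (hat δ) (Icc 0 T)
  anti : AntitoneOn (hat δ) (Icc T 1)
  lt : ∀ x ∈ Icc (0 : ℝ) 1, T < x → hat δ x < hat δ T

theorem lipschitzOnWith_of_lip {w : ℝ → ℝ}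
    (hw : ∀ x ∈ Icc (0 : ℝ) 1, ∀ y ∈ Icc (0 : ℝ) 1, x ≤ y →
      w y ≤ w x + (y - x) ∧ w x ≤ w y + (y - x)) : LipschitzOnWith 1 w (Icc 0 1) := by
  refine LipschitzOnWith.of_dist_le_mul fun x hx y hy => ?_
  rw [Real.dist_eq, Real.dist_eq, NNReal.coe_one, one_mul]
  rcases le_total x y with h | h
  · have := hw x hx y hy h
    rw [abs_of_nonpos (sub_nonpos.2 h), abs_le]
    constructor <;> linarith
  · have := hw y hy x hx h
    rw [abs_of_nonneg (sub_nonneg.2 h), abs_le]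
    constructor <;> linarith

theorem IsDiagonalSection.exists_hasPeak {δ : ℝ → ℝ} (hδ : IsDiagonalSection δ)
    (hs : IsSimple δ) : ∃ T, HasPeak δ T := by
  obtain ⟨Q, hQ, hd⟩ := hδ
  replace hQ : IsQuasiCopula Q := hQ.elim IsCopula.isQuasiCopula id
  have hlip : ∀ x ∈ Icc (0 : ℝ) 1, ∀ y ∈ Icc (0 : ℝ) 1, x ≤ y →
      hat δ y ≤ hat δ x + (y - x) ∧ hat δ x ≤ hat δ y + (y - x) := by
    intro x hx y hy h
    have h1 := hQ.mono_left x hx hx hy h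
    have h2 := hQ.mono_right y hy hx hy h
    have h3 := (abs_le.1 (hQ.lipschitz x hx x hx y hy y hy)).1
    rw [abs_of_nonpos (sub_nonpos.2 h), hd x hx, hd y hy] at h3
    simp only [hd x hx, hd y hy] at h1 h2
    unfold hat
    constructor <;> linarith
  have hcont := (lipschitzOnWith_of_lip hlip).continuousOn
  obtain ⟨t₀, ht₀, hmono, hanti⟩ := hs
  -- The given `t₀` may sit anywhere on the plateau of maximizers; it is replaced by the right end
  -- of the plateau.
  have hK : IsCompact {x | x ∈ Icc t₀ 1 ∧ hat δ x = hat δ t₀} :=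
    isCompact_Icc.of_isClosed_subset
      ((hcont.mono (Icc_subset_Icc_left ht₀.1)).preimage_isClosed_of_isClosed isClosed_Icc
        (isClosed_singleton (x := hat δ t₀))) (fun x hx => hx.1)
  obtain ⟨T, ⟨hT, hTw⟩, hmax⟩ := hK.exists_isGreatest ⟨t₀, ⟨le_rfl, ht₀.2⟩, rfl⟩
  have hplateau : ∀ x ∈ Icc t₀ T, hat δ x = hat δ t₀ := fun x hx =>
    le_antisymm (hanti ⟨le_rfl, ht₀.2⟩ ⟨hx.1, hx.2.trans hT.2⟩ hx.1)
      (hTw ▸ hanti ⟨hx.1, hx.2.trans hT.2⟩ hT hx.2)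
  have hT0 : 0 ≤ T := ht₀.1.trans hT.1
  refine ⟨T, ?_, ?_, ?_, hlip, ⟨hT0, hT.2⟩, ?_, hanti.mono (Icc_subset_Icc_left hT.1), ?_⟩
  · intro x hx
    have h1 := hQ.mono_right x hx hx unit_one_mem hx.2
    simp only [hd x hx, (hQ.marginals x hx).1] at h1
    unfold hat
    linarith
  · rw [hat, ← hd 0 unit_zero_mem, (hQ.grounded 0 unit_zero_mem).1, sub_zero]
  · rw [hat, ← hd 1 unit_one_mem, (hQ.marginals 1 unit_one_mem).1, sub_self]
  · intro x hx y hy hxy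
    rcases le_total y t₀ with hyt | hyt
    · exact hmono ⟨hx.1, hxy.trans hyt⟩ ⟨hy.1, hyt⟩ hxy
    rw [hplateau y ⟨hyt, hy.2⟩]
    rcases le_total x t₀ with hxt | hxt
    · exact hmono ⟨hx.1, hxt⟩ ⟨ht₀.1, le_rfl⟩ hxt
    · exact (hplateau x ⟨hxt, hx.2⟩).le
  · intro x hx hTx
    have hx' : x ∈ Icc t₀ 1 := ⟨hT.1.trans hTx.le, hx.2⟩
    refine lt_of_le_of_ne (hanti hT hx' hTx.le) fun he => ?_
    exact absurd (hmax ⟨hx', he.trans hTw⟩) (not_le.2 hTx)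

namespace HasPeak

variable {δ : ℝ → ℝ} {T : ℝ}

theorem continuousOn (p : HasPeak δ T) : ContinuousOn (hat δ) (Icc 0 1) :=
  (lipschitzOnWith_of_lip p.lip).continuousOn

theorem le_peak (p : HasPeak δ T) {x : ℝ} (hx : x ∈ Icc (0 : ℝ) 1) : hat δ x ≤ hat δ T := by
  rcases le_total x T with h | h
  · exact p.mono ⟨hx.1, h⟩ ⟨p.mem.1, le_rfl⟩ h
  · exact p.anti ⟨le_rfl, p.mem.2⟩ ⟨h, hx.2⟩ h

theorem peak_nonneg (p : HasPeak δ T) : 0 ≤ hat δ T := p.nonneg T p.mem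

theorem add_peak_le_one (p : HasPeak δ T) : T + hat δ T ≤ 1 := by
  have := (p.lip T p.mem 1 unit_one_mem p.mem.2).2
  rw [p.one] at this
  linarith

theorem peak_le (p : HasPeak δ T) : hat δ T ≤ T := by
  have := (p.lip 0 unit_zero_mem T p.mem p.mem.1).1
  rw [p.zero] at this
  linarith

/-- This is the reason for choosing the largest maximizer: beyond it `hat δ` is strictly below its
maximum. -/
theorem le_of_monotoneOn (p : HasPeak δ T) {x : ℝ} (hx : x ∈ Icc (0 : ℝ) 1)
    (h : MonotoneOn (hat δ) (Icc 0 x)) : x ≤ T := by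
  by_contra! hlt
  exact absurd (h ⟨p.mem.1, hlt.le⟩ ⟨hx.1, le_rfl⟩ hlt.le) (not_le.2 (p.lt x hx hlt))

/-! ### The set `D_f(δ)` and the function `g_U^δ` -/

theorem variation_of_monotoneOn {w : ℝ → ℝ} {x y : ℝ} (hx : 0 ≤ x) (hxy : x ≤ y) (hy : y ≤ 1)
    (hw : MonotoneOn w (Icc x y)) : variationOnFromTo w (Icc 0 1) x y = w y - w x := by
  rw [variationOnFromTo.eq_of_le _ _ hxy, inter_eq_right.2 (Icc_subset_Icc hx hy)]
  have := hw.eVariationOn_eq (left_mem_Icc.2 hxy) (right_mem_Icc.2 hxy)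
  rw [inter_self] at this
  rw [this, ENNReal.toReal_ofReal]
  linarith [hw (left_mem_Icc.2 hxy) (right_mem_Icc.2 hxy) hxy]

theorem variation_of_antitoneOn {w : ℝ → ℝ} {x y : ℝ} (hx : 0 ≤ x) (hxy : x ≤ y) (hy : y ≤ 1)
    (hw : AntitoneOn w (Icc x y)) : variationOnFromTo w (Icc 0 1) x y = w x - w y := by
  have h1 := variation_of_monotoneOn hx hxy hy hw.neg
  have h2 : variationOnFromTo (fun x => -w x) (Icc 0 1) x y = variationOnFromTo w (Icc 0 1) x y := by
    simp only [variationOnFromTo, eVariationOn, edist_neg_neg]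
  rw [h2] at h1
  rw [h1]
  ring

theorem locallyBoundedVariationOn (p : HasPeak δ T) :
    LocallyBoundedVariationOn (hat δ) (Icc 0 1) :=
  (lipschitzOnWith_of_lip p.lip).locallyBoundedVariationOn

theorem f_eq (p : HasPeak δ T) {x y : ℝ} (hx : x ∈ Icc 0 T) (hy : y ∈ Icc T 1) :
    f δ x y = y - hat δ T := by
  have h1 := variation_of_monotoneOn hx.1 hx.2 p.mem.2 (p.mono.mono (Icc_subset_Icc_left hx.1))
  have h2 := variation_of_antitoneOn p.mem.1 hy.1 hy.2 (p.anti.mono (Icc_subset_Icc_right hy.2))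
  have h3 := variationOnFromTo.add p.locallyBoundedVariationOn
    (show x ∈ Icc (0 : ℝ) 1 from ⟨hx.1, hx.2.trans p.mem.2⟩) p.mem
    (show y ∈ Icc (0 : ℝ) 1 from ⟨p.mem.1.trans hy.1, hy.2⟩)
  rw [f, ← h3, h1, h2]
  ring

/-- On one side of the peak the variation telescopes, so `f δ x y` is `y - hat δ y` (left) or `y -
hat δ x` (right). -/
theorem le_f (p : HasPeak δ T) {x y : ℝ} (hx : x ∈ Icc (0 : ℝ) 1) (hy : y ∈ Icc (0 : ℝ) 1)
    (hxy : x ≤ y) : y - hat δ T ≤ f δ x y := by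
  rcases le_total y T with hyT | hyT
  · rw [f, variation_of_monotoneOn hx.1 hxy hy.2 (p.mono.mono (Icc_subset_Icc hx.1 hyT))]
    linarith [p.le_peak hy]
  rcases le_total x T with hxT | hxT
  · exact (p.f_eq ⟨hx.1, hxT⟩ ⟨hyT, hy.2⟩).ge
  · rw [f, variation_of_antitoneOn hx.1 hxy hy.2 (p.anti.mono (Icc_subset_Icc hxT hy.2))]
    linarith [p.le_peak hx]

theorem snd_le_of_mem_Df (p : HasPeak δ T) {q : ℝ × ℝ} (hq : q ∈ Df δ) :
    q.2 ≤ q.1 + hat δ T := by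
  rcases hq with hq | hq
  · have hcl : IsClosed {q : ℝ × ℝ | q.2 ≤ q.1 + hat δ T} :=
      isClosed_le continuous_snd (continuous_fst.add continuous_const)
    refine closure_minimal (fun r hr => ?_) hcl hq
    rcases le_total r.1 r.2 with h | h
    · have h1 := p.le_f hr.1 hr.2.1 h
      have h2 := hr.2.2.trans_le (min_le_left _ _)
      show r.2 ≤ r.1 + hat δ T
      linarith
    · exact h.trans (le_add_of_nonneg_right p.peak_nonneg)
  · rw [← hq.2]
    exact le_add_of_nonneg_right p.peak_nonneg

theorem mem_Df (p : HasPeak δ T) {x : ℝ} (hx : x ∈ Icc (T - hat δ T) T) :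
    (x, x + hat δ T) ∈ Df δ := by
  have hx0 : 0 ≤ x := by linarith [p.peak_le, hx.1]
  have h1 := p.add_peak_le_one
  rcases p.peak_nonneg.eq_or_lt with hm | hm
  · right
    rw [← hm]
    exact ⟨⟨hx0, hx.2.trans p.mem.2⟩, (add_zero x).symm⟩
  left
  -- The boundary point is approached along the segment towards `(T, T)`. At parameter `s` the gap
  -- between the coordinates is `(1 - s) * hat δ T`, which gives the strict inequality defining
  -- `DfOpen`.
  have hcont : Tendsto (fun s : ℝ => (x + s * (T - x), x + hat δ T - s * (x + hat δ T - T)))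
      (𝓝[>] 0) (𝓝 (x, x + hat δ T)) := by
    have : Continuous fun s : ℝ => (x + s * (T - x), x + hat δ T - s * (x + hat δ T - T)) := by
      fun_prop
    have h := this.tendsto 0
    simp only [zero_mul, add_zero, sub_zero] at h
    exact h.mono_left nhdsWithin_le_nhds
  refine mem_closure_of_tendsto hcont ?_
  filter_upwards [Ioo_mem_nhdsGT (zero_lt_one (α := ℝ))] with s hs
  have ha : 0 ≤ s * (T - x) := mul_nonneg hs.1.le (by linarith [hx.2])
  have ha' : s * (T - x) ≤ T - x := mul_le_of_le_one_left (by linarith [hx.2]) hs.2.le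
  have hb : 0 ≤ s * (x + hat δ T - T) := mul_nonneg hs.1.le (by linarith [hx.1])
  have hb' : s * (x + hat δ T - T) ≤ x + hat δ T - T :=
    mul_le_of_le_one_left (by linarith [hx.1]) hs.2.le
  have hc : 0 < s * hat δ T := mul_pos hs.1 hm
  have hd : s * (T - x) + s * (x + hat δ T - T) = s * hat δ T := by ring
  have hT := p.mem
  refine ⟨⟨by dsimp only; linarith, by dsimp only; linarith [hT.2]⟩,
    ⟨by dsimp only; linarith [hT.1], by dsimp only; linarith [hx.2]⟩, ?_⟩
  dsimp only
  rw [p.f_eq ⟨by linarith, by linarith⟩ ⟨by linarith, by linarith [hx.2]⟩]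
  refine lt_min (by linarith) (by linarith)

theorem gU_le (p : HasPeak δ T) {x : ℝ} (hx : x ∈ Icc (0 : ℝ) 1) : gU δ x ≤ x + hat δ T :=
  csSup_le ⟨x, hx, Or.inr ⟨hx, rfl⟩⟩ fun _ hy => p.snd_le_of_mem_Df hy.2

theorem gU_eq (p : HasPeak δ T) {x : ℝ} (hx : x ∈ Icc (T - hat δ T) T) :
    gU δ x = x + hat δ T := by
  have hx0 : 0 ≤ x := by linarith [p.peak_le, hx.1]
  have h1 := p.add_peak_le_one
  refine le_antisymm (p.gU_le ⟨hx0, hx.2.trans p.mem.2⟩) (le_csSup ⟨1, fun y hy => hy.1.2⟩ ?_)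
  exact ⟨⟨by linarith [p.peak_nonneg], by linarith [hx.2]⟩, p.mem_Df hx⟩

/-! ### The function `h^δ` and the set `H_δ` -/

theorem bddAbove_h_set (δ : ℝ → ℝ) (x : ℝ) :
    BddAbove {y : ℝ | y ∈ Icc (0 : ℝ) 1 ∧ x ≤ y ∧ ∀ t ∈ Icc x y, hat δ x ≤ hat δ t} :=
  ⟨1, fun _ hy => hy.1.2⟩

theorem h_le_one {x : ℝ} (hx : x ∈ Icc (0 : ℝ) 1) : h δ x ≤ 1 :=
  csSup_le ⟨x, hx, le_rfl, fun t ht => by rw [le_antisymm ht.2 ht.1]⟩ fun _ hy => hy.1.2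

/-- Unimodality reduces the condition on all of `[x, y]` to its right endpoint; the Lipschitz bound
carries it to the supremum. -/
theorem le_h_iff (p : HasPeak δ T) {x y : ℝ} (hx : x ∈ Icc 0 T) (hy : y ∈ Icc T 1) :
    y ≤ h δ x ↔ hat δ x ≤ hat δ y := by
  have hT := p.mem
  have hxI : x ∈ Icc (0 : ℝ) 1 := ⟨hx.1, hx.2.trans hT.2⟩
  constructor
  · intro hle
    have hne : {y : ℝ | y ∈ Icc (0 : ℝ) 1 ∧ x ≤ y ∧
        ∀ t ∈ Icc x y, hat δ x ≤ hat δ t}.Nonempty :=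
      ⟨x, hxI, le_rfl, fun t ht => by rw [le_antisymm ht.2 ht.1]⟩
    refine le_of_forall_pos_le_add fun ε hε => ?_
    obtain ⟨z, ⟨hz, hxz, hzt⟩, hlt⟩ := exists_lt_of_lt_csSup hne
      (show y - ε < sSup _ from (sub_lt_self y hε).trans_le hle)
    rcases le_total y z with hyz | hyz
    · linarith [hzt y ⟨hx.2.trans hy.1, hyz⟩]
    · have h1 := (p.lip z hz y ⟨hT.1.trans hy.1, hy.2⟩ hyz).2
      linarith [hzt z ⟨hxz, le_rfl⟩]
  · intro hle
    refine le_csSup (bddAbove_h_set δ x) ⟨⟨hT.1.trans hy.1, hy.2⟩, hx.2.trans hy.1, ?_⟩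
    intro t ht
    rcases le_total t T with htT | htT
    · exact p.mono hx ⟨hx.1.trans ht.1, htT⟩ ht.1
    · exact hle.trans (p.anti ⟨htT, ht.2.trans hy.2⟩ hy ht.2)

theorem peak_le_h (p : HasPeak δ T) {x : ℝ} (hx : x ∈ Icc (0 : ℝ) 1) : T ≤ h δ x := by
  rcases le_total x T with hxT | hxT
  · exact (p.le_h_iff ⟨hx.1, hxT⟩ ⟨le_rfl, p.mem.2⟩).2 (p.le_peak hx)
  · exact hxT.trans (le_csSup (bddAbove_h_set δ x)
      ⟨hx, le_rfl, fun t ht => by rw [le_antisymm ht.2 ht.1]⟩)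

theorem h_antitone (p : HasPeak δ T) {x y : ℝ} (hx : 0 ≤ x) (hxy : x ≤ y) (hy : y ≤ T) :
    h δ y ≤ h δ x := by
  have hyI : y ∈ Icc (0 : ℝ) 1 := ⟨hx.trans hxy, hy.trans p.mem.2⟩
  have hm : h δ y ∈ Icc T 1 := ⟨p.peak_le_h hyI, h_le_one hyI⟩
  exact (p.le_h_iff ⟨hx, hxy.trans hy⟩ hm).2
    ((p.mono ⟨hx, hxy.trans hy⟩ ⟨hyI.1, hy⟩ hxy).trans ((p.le_h_iff ⟨hyI.1, hy⟩ hm).1 le_rfl))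

theorem neBot_punctured {x : ℝ} (hx : x ∈ Icc (0 : ℝ) 1) :
    (𝓝[Icc (0 : ℝ) 1 \ {x}] x).NeBot := by
  rcases hx.2.eq_or_lt with rfl | h1
  · have : (𝓝[Ioo (0 : ℝ) 1] 1).NeBot := right_nhdsWithin_Ioo_neBot zero_lt_one
    exact this.mono (nhdsWithin_mono _ fun y hy => ⟨⟨hy.1.le, hy.2.le⟩, hy.2.ne⟩)
  · have : (𝓝[Ioo x 1] x).NeBot := left_nhdsWithin_Ioo_neBot h1
    exact this.mono (nhdsWithin_mono _ fun y hy => ⟨⟨hx.1.trans hy.1.le, hy.2.le⟩, hy.1.ne'⟩)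

theorem le_hLiminf {x c : ℝ} (hx : x ∈ Icc (0 : ℝ) 1)
    (hc : ∀ᶠ t in 𝓝[Icc (0 : ℝ) 1 \ {x}] x, c ≤ h δ t) : c ≤ hLiminf δ x := by
  have := neBot_punctured hx
  refine le_liminf_of_le (IsBoundedUnder.isCoboundedUnder_ge ⟨1, ?_⟩) hc
  rw [eventually_map]
  filter_upwards [self_mem_nhdsWithin] with t ht using h_le_one ht.1

theorem hLiminf_le (p : HasPeak δ T) {x c : ℝ}
    (hc : ∀ ε > 0, ∃ᶠ t in 𝓝[Icc (0 : ℝ) 1 \ {x}] x, h δ t ≤ c + ε) : hLiminf δ x ≤ c := by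
  rw [hLiminf, liminf_eq]
  refine csSup_le ⟨T, ?_⟩ fun a ha => le_of_forall_pos_le_add fun ε hε => ?_
  · filter_upwards [self_mem_nhdsWithin] with t ht using p.peak_le_h ht.1
  · obtain ⟨t, ht1, ht2⟩ := ((hc ε hε).and_eventually ha).exists
    exact ht2.trans ht1

/-- The largest `x ∈ [δ(T), T]` with `hat δ x ≤ hat δ (x + hat δ T)`. -/
structure IsCrossing (δ : ℝ → ℝ) (T a : ℝ) : Prop where
  mem : a ∈ Icc (T - hat δ T) T
  le : hat δ a ≤ hat δ (a + hat δ T)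
  lt : ∀ x ∈ Icc (T - hat δ T) T, a < x → hat δ (x + hat δ T) < hat δ x

theorem exists_crossing (p : HasPeak δ T) : ∃ a, IsCrossing δ T a := by
  have hT := p.mem
  have h0 := p.peak_nonneg
  have h1 := p.add_peak_le_one
  have h2 := p.peak_le
  have hK : IsCompact {x | x ∈ Icc (T - hat δ T) T ∧ hat δ x ≤ hat δ (x + hat δ T)} := by
    refine isCompact_Icc.of_isClosed_subset (isClosed_Icc.isClosed_le ?_ ?_) fun x hx => hx.1
    · exact p.continuousOn.mono (Icc_subset_Icc (by linarith) hT.2)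
    · exact p.continuousOn.comp (by fun_prop)
        fun x hx => ⟨by linarith [hx.1, hT.1], by linarith [hx.2]⟩
  -- The left endpoint always qualifies, since shifting it by `hat δ T` lands on the peak.
  obtain ⟨a, ha, hmax⟩ := hK.exists_isGreatest ⟨T - hat δ T, ⟨le_rfl, by linarith⟩, by
    rw [sub_add_cancel]
    exact p.le_peak ⟨by linarith, by linarith [hT.2]⟩⟩
  refine ⟨a, ha.1, ha.2, fun x hx hax => ?_⟩
  by_contra! hle
  exact absurd (hmax ⟨hx, hle⟩) (not_le.2 hax)

/-- Just to the right of `a` the inequality is reversed, so continuity forces equality; if `a = T`,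
maximality of the peak does. -/
theorem IsCrossing.eq (p : HasPeak δ T) {a : ℝ} (c : IsCrossing δ T a) :
    hat δ a = hat δ (a + hat δ T) := by
  have h0 := p.peak_nonneg
  have h1 := p.add_peak_le_one
  have h2 := p.peak_le
  have hT := p.mem
  have ha := c.mem
  refine le_antisymm c.le ?_
  rcases ha.2.eq_or_lt with rfl | haT
  · exact p.le_peak ⟨by linarith, h1⟩
  refine le_of_forall_pos_le_add fun ε hε => ?_
  obtain ⟨x, hax, hx⟩ := exists_between (lt_min haT (lt_add_of_pos_right a (half_pos hε)))
  have hxT := hx.trans_le (min_le_left _ _)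
  have hxε := hx.trans_le (min_le_right _ _)
  have h3 := c.lt x ⟨by linarith [ha.1], hxT.le⟩ hax
  have h4 := (p.lip a ⟨by linarith [ha.1], by linarith [hT.2]⟩ x
    ⟨by linarith [ha.1], by linarith [hT.2]⟩ hax.le).1
  have h5 := (p.lip (a + hat δ T) ⟨by linarith [ha.1], by linarith⟩ (x + hat δ T)
    ⟨by linarith [ha.1], by linarith⟩ (by linarith)).2
  linarith

theorem IsCrossing.mem_H (p : HasPeak δ T) {a : ℝ} (c : IsCrossing δ T a) :
    (a, gU δ a) ∈ H δ := by
  have h0 := p.peak_nonneg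
  have h1 := p.add_peak_le_one
  have h2 := p.peak_le
  have hT := p.mem
  have ha := c.mem
  have ha0 : 0 ≤ a := by linarith [ha.1]
  have haI : a ∈ Icc (0 : ℝ) 1 := ⟨ha0, ha.2.trans hT.2⟩
  rw [p.gU_eq ha]
  have hle : a + hat δ T ≤ h δ a :=
    (p.le_h_iff ⟨ha0, ha.2⟩ ⟨by linarith [ha.1], by linarith [ha.2]⟩).2 c.le
  rcases hle.eq_or_lt with heq | hlt
  · exact Or.inl ⟨haI, heq⟩
  -- If the line passes strictly below `h δ a`, then `h δ` lies below the line to the right of `a`.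
  -- So `h δ` jumps at `a`, and the point lies on the added vertical segment.
  have hstep : ∀ x, a < x → x ≤ T → h δ x < x + hat δ T := fun x hax hxT => by
    by_contra! hge
    have h3 := (p.le_h_iff ⟨ha0.trans hax.le, hxT⟩
      ⟨by linarith [ha.1], by linarith⟩).1 hge
    exact absurd h3 (not_le.2 (c.lt x ⟨ha.1.trans hax.le, hxT⟩ hax))
  have haT : a < T := by
    refine lt_of_le_of_ne ha.2 ?_
    rintro rfl
    have h3 := (p.le_h_iff ⟨ha0, le_rfl⟩ ⟨p.peak_le_h haI, h_le_one haI⟩).1 le_rfl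
    exact absurd h3 (not_le.2 (p.lt _ ⟨by linarith, h_le_one haI⟩ (by linarith)))
  have hright : Ioo a T ⊆ Icc (0 : ℝ) 1 \ {a} := fun x hx =>
    ⟨⟨ha0.trans hx.1.le, hx.2.le.trans hT.2⟩, hx.1.ne'⟩
  have hne : (𝓝[Ioo a T] a).NeBot := left_nhdsWithin_Ioo_neBot haT
  refine Or.inr (mem_iUnion₂.2 ⟨a, ⟨haI, fun hcont => ?_⟩, rfl, ?_, hle⟩)
  · have ht1 : Tendsto (h δ) (𝓝[Ioo a T] a) (𝓝 (h δ a)) :=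
      hcont.mono fun x hx => (hright hx).1
    have ht2 : Tendsto (fun x => x + hat δ T) (𝓝[Ioo a T] a) (𝓝 (a + hat δ T)) :=
      ((continuous_add_const (hat δ T)).tendsto a).mono_left nhdsWithin_le_nhds
    refine absurd (le_of_tendsto_of_tendsto ht1 ht2 ?_) (not_le.2 hlt)
    filter_upwards [self_mem_nhdsWithin] with x hx using (hstep x hx.1 hx.2.le).le
  · refine p.hLiminf_le fun ε hε => ?_
    have hev : ∀ᶠ x in 𝓝[Ioo a T] a, h δ x ≤ a + hat δ T + ε := by
      filter_upwards [self_mem_nhdsWithin,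
        mem_nhdsWithin_of_mem_nhds (Iio_mem_nhds (lt_add_of_pos_right a hε))] with x hx hxε
      have := hstep x hx.1 hx.2.le
      have : x < a + ε := hxε
      linarith
    exact hev.frequently.filter_mono (nhdsWithin_mono _ hright)

theorem IsCrossing.eq_of_mem_H (p : HasPeak δ T) {a x : ℝ} (c : IsCrossing δ T a)
    (hx : x ∈ Icc 0 T) (hH : (x, gU δ x) ∈ H δ) : x = a := by
  have h0 := p.peak_nonneg
  have h1 := p.add_peak_le_one
  have h2 := p.peak_le
  have hT := p.mem
  have ha := c.mem
  have ha0 : 0 ≤ a := by linarith [ha.1]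
  have hxI : x ∈ Icc (0 : ℝ) 1 := ⟨hx.1, hx.2.trans hT.2⟩
  have hcases : gU δ x = h δ x ∨ (hLiminf δ x ≤ gU δ x ∧ gU δ x ≤ h δ x) := by
    rcases hH with hH | hH
    · exact Or.inl hH.2
    · obtain ⟨z, _, hz, hz'⟩ := mem_iUnion₂.1 hH
      obtain rfl : x = z := hz
      exact Or.inr hz'
  -- All of `H δ` lies at height at least `T`, which forces `x` into the range where `gU δ` is known
  -- exactly.
  have hTg : T ≤ gU δ x := by
    rcases hcases with heq | hl
    · exact heq ▸ p.peak_le_h hxI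
    · refine le_trans (le_hLiminf hxI ?_) hl.1
      filter_upwards [self_mem_nhdsWithin] with t ht using p.peak_le_h ht.1
  have hxm : x ∈ Icc (T - hat δ T) T := ⟨by linarith [p.gU_le hxI], hx.2⟩
  rw [p.gU_eq hxm] at hcases hTg
  have hle : x + hat δ T ≤ h δ x := hcases.elim Eq.le And.right
  have hxw := (p.le_h_iff hx ⟨hTg, by linarith [hx.2]⟩).1 hle
  rcases lt_trichotomy x a with hlt | heq | hgt
  -- To the left of `a`, antitonicity keeps `h δ`, and with it the liminf at `x`, at or above `a +
  -- hat δ T > x + hat δ T`.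
  · have haw : a + hat δ T ≤ h δ a :=
      (p.le_h_iff ⟨ha0, ha.2⟩ ⟨by linarith [ha.1], by linarith [ha.2]⟩).2 c.le
    have hge : ∀ t ∈ Icc (0 : ℝ) 1, t < a → a + hat δ T ≤ h δ t := fun t ht hta =>
      haw.trans (p.h_antitone ht.1 hta.le ha.2)
    rcases hcases with heq | hl
    · linarith [hge x hxI hlt]
    · have : a + hat δ T ≤ hLiminf δ x := le_hLiminf hxI (by
        filter_upwards [self_mem_nhdsWithin, mem_nhdsWithin_of_mem_nhds (Iio_mem_nhds hlt)]
          with t ht hta using hge t ht.1 hta)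
      linarith [hl.1]
  · exact heq
  · exact absurd hxw (not_le.2 (c.lt x hxm hgt))

end HasPeak

/-! ### Sums of comonotone couplings -/

/-- Supermodularity of `min`, which makes each summand `min (P i x) (Q i y)` 2-increasing. -/
theorem min_add_min_le {p p' q q' : ℝ} (hp : p ≤ p') (hq : q ≤ q') :
    min p' q + min p q' ≤ min p' q' + min p q := by
  rcases le_total p' q' with h1 | h1
  · rw [min_eq_left h1, min_eq_left (hp.trans h1)]
    rcases le_total p q with h2 | h2
    · rw [min_eq_left h2]
      linarith [min_le_left p' q]
    · rw [min_eq_right h2, min_eq_right (h2.trans hp)]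
      linarith
  · rw [min_eq_right h1, min_eq_right (hq.trans h1)]
    rcases le_total p q with h2 | h2
    · rw [min_eq_left h2, min_eq_left (h2.trans hq)]
      linarith
    · rw [min_eq_right h2]
      linarith [min_le_right p q']

theorem isCopula_of_twoIncreasing {C : ℝ → ℝ → ℝ} (h0 : Grounded C) (h1 : UniformMarginals C)
    (h2 : TwoIncreasing C) : IsCopula C where
  mapsTo x hx y hy := by
    have e1 := h2 0 unit_zero_mem x hx 0 unit_zero_mem y hy hx.1 hy.1
    have e2 := h2 0 unit_zero_mem x hx y hy 1 unit_one_mem hx.1 hy.2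
    simp only [rectVolume, (h0 x hx).1, (h0 y hy).2, (h0 0 unit_zero_mem).1,
      (h0 1 unit_one_mem).2, (h1 x hx).1] at e1 e2
    exact ⟨by linarith, by linarith [hx.2]⟩
  grounded := h0
  marginals := h1
  twoIncreasing := h2

theorem isCopula_sum_min {ι : Type*} [Fintype ι] {P Q : ι → ℝ → ℝ}
    (hP : ∀ i, MonotoneOn (P i) (Icc 0 1)) (hQ : ∀ i, MonotoneOn (Q i) (Icc 0 1))
    (hP0 : ∀ i, P i 0 = 0) (hQ0 : ∀ i, Q i 0 = 0) (h1 : ∀ i, P i 1 = Q i 1)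
    (hPs : ∀ x ∈ Icc (0 : ℝ) 1, ∑ i, P i x = x) (hQs : ∀ x ∈ Icc (0 : ℝ) 1, ∑ i, Q i x = x) :
    IsCopula fun x y => ∑ i, min (P i x) (Q i y) := by
  refine isCopula_of_twoIncreasing (fun x hx => ⟨?_, ?_⟩) (fun x hx => ⟨?_, ?_⟩) ?_
  · refine Finset.sum_eq_zero fun i _ => ?_
    rw [hQ0, min_eq_right (hP0 i ▸ hP i unit_zero_mem hx hx.1)]
  · refine Finset.sum_eq_zero fun i _ => ?_
    rw [hP0, min_eq_left (hQ0 i ▸ hQ i unit_zero_mem hx hx.1)]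
  · refine (Finset.sum_congr rfl fun i _ => ?_).trans (hPs x hx)
    rw [← h1, min_eq_left (hP i hx unit_one_mem hx.2)]
  · refine (Finset.sum_congr rfl fun i _ => ?_).trans (hQs x hx)
    rw [h1, min_eq_right (hQ i hx unit_one_mem hx.2)]
  · intro a ha b hb c hc d hd hab hcd
    have := Finset.sum_le_sum fun i (_ : i ∈ Finset.univ) =>
      min_add_min_le (hP i ha hb hab) (hQ i hc hd hcd)
    simp only [Finset.sum_add_distrib] at this
    unfold rectVolume
    linarith

namespace HasPeak

variable {δ : ℝ → ℝ} {T : ℝ}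

/-! ### A copula with diagonal section `δ` and maximal asymmetry -/

theorem forall_fin_six {q : Fin 6 → Prop} :
    (∀ i, q i) ↔ q 0 ∧ q 1 ∧ q 2 ∧ q 3 ∧ q 4 ∧ q 5 := by
  simp [Fin.forall_fin_succ]

/-- First marginals of the parts of `crossingCopula`. -/
noncomputable def leftPart (w : ℝ → ℝ) (T a b : ℝ) : Fin 6 → ℝ → ℝ :=
  ![fun x => min x a - w (min x a),
    fun x => max x b + w (max x b) - b - w b,
    fun x => w (min x a),
    fun x => max a (min x T) - a + (max T (min x b) + w (max T (min x b))) - T - w T,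
    fun x => w T - w (max T (min x b)),
    fun x => w b - w (max x b)]

/-- Second marginals of the parts of `crossingCopula`. -/
noncomputable def rightPart (w : ℝ → ℝ) (T a b : ℝ) : Fin 6 → ℝ → ℝ :=
  ![fun y => min y a - w (min y a),
    fun y => max y b + w (max y b) - b - w b,
    fun y => max a (min y T) - w (max a (min y T)) - a + w a + (max T (min y b) - T),
    fun y => w b - w (max y b),
    fun y => w (max a (min y T)) - w a,
    fun y => w (min y a)]

/-- A copula sending no mass to `[0,a] × [b,1]` and to `[a,b] × [0,a]`. -/
noncomputable def crossingCopula (w : ℝ → ℝ) (T a b x y : ℝ) : ℝ :=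
  ∑ i, min (leftPart w T a b i x) (rightPart w T a b i y)

theorem clamp_sum {T a b : ℝ} (haT : a ≤ T) (hTb : T ≤ b) (x : ℝ) :
    min x a + max a (min x T) + max T (min x b) + max x b = x + a + T + b := by
  rcases le_total x a with h1 | h1
  · rw [min_eq_left h1, min_eq_left (h1.trans haT), max_eq_left h1,
      min_eq_left (h1.trans (haT.trans hTb)), max_eq_left (h1.trans haT),
      max_eq_right (h1.trans (haT.trans hTb))]
  rw [min_eq_right h1]
  rcases le_total x T with h2 | h2
  · rw [min_eq_left h2, max_eq_right h1, min_eq_left (h2.trans hTb), max_eq_left h2,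
      max_eq_right (h2.trans hTb)]
    ring
  rw [min_eq_right h2, max_eq_right haT]
  rcases le_total x b with h3 | h3
  · rw [min_eq_left h3, max_eq_right h2, max_eq_right h3]
    ring
  · rw [min_eq_right h3, max_eq_right hTb, max_eq_left h3]
    ring

section

variable {a b : ℝ}

/-- Parts 0 and 1 couple `[0, a]` and `[b, 1]` with themselves. Part 2 sends `[0, a]` to `[a, b]`,
part 3 `[a, b]` to `[b, 1]`, part 4 `[T, b]` to `[a, T]`, and part 5 `[b, 1]` to `[0, a]`. Their
masses are `hat δ a`, `hat δ b`, `hat δ T - hat δ a` and `hat δ a`. The parts in each variable add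
up to Lebesgue measure, and they are monotone because `hat δ` is unimodal and 1-Lipschitz. -/
theorem isCopula_crossingCopula (p : HasPeak δ T) (ha : 0 ≤ a) (haT : a ≤ T) (hTb : T ≤ b)
    (hb : b ≤ 1) (hab : b = a + hat δ T) (hw : hat δ a = hat δ b) :
    IsCopula (crossingCopula (hat δ) T a b) := by
  have hT := p.mem
  have hb0 : 0 ≤ b := hT.1.trans hTb
  have hcA : ∀ x ∈ Icc (0 : ℝ) 1, min x a ∈ Icc 0 a := fun x hx =>
    ⟨le_min hx.1 ha, min_le_right _ _⟩
  have hc1 : ∀ x : ℝ, max a (min x T) ∈ Icc a T := fun x =>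
    ⟨le_max_left _ _, max_le haT (min_le_right _ _)⟩
  have hc2 : ∀ x : ℝ, max T (min x b) ∈ Icc T b := fun x =>
    ⟨le_max_left _ _, max_le hTb (min_le_right _ _)⟩
  have hcE : ∀ x ∈ Icc (0 : ℝ) 1, max x b ∈ Icc b 1 := fun x hx =>
    ⟨le_max_right _ _, max_le hx.2 hb⟩
  have hwA : MonotoneOn (fun x => hat δ (min x a)) (Icc 0 1) := fun x hx y hy h =>
    p.mono ⟨(hcA x hx).1, (hcA x hx).2.trans haT⟩ ⟨(hcA y hy).1, (hcA y hy).2.trans haT⟩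
      (min_le_min_right a h)
  have hw1 : MonotoneOn (fun x => hat δ (max a (min x T))) (Icc 0 1) := fun x _ y _ h =>
    p.mono ⟨ha.trans (hc1 x).1, (hc1 x).2⟩ ⟨ha.trans (hc1 y).1, (hc1 y).2⟩
      (max_le_max_left a (min_le_min_right T h))
  have hw2 : AntitoneOn (fun x => hat δ (max T (min x b))) (Icc 0 1) := fun x _ y _ h =>
    p.anti ⟨(hc2 x).1, (hc2 x).2.trans hb⟩ ⟨(hc2 y).1, (hc2 y).2.trans hb⟩
      (max_le_max_left T (min_le_min_right b h))
  have hwE : AntitoneOn (fun x => hat δ (max x b)) (Icc 0 1) := fun x hx y hy h =>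
    p.anti ⟨hTb.trans (hcE x hx).1, (hcE x hx).2⟩ ⟨hTb.trans (hcE y hy).1, (hcE y hy).2⟩
      (max_le_max_right b h)
  have hlA : ∀ x ∈ Icc (0 : ℝ) 1, ∀ y ∈ Icc (0 : ℝ) 1, x ≤ y →
      hat δ (min y a) ≤ hat δ (min x a) + (min y a - min x a) := fun x hx y hy h =>
    (p.lip _ ⟨(hcA x hx).1, (min_le_left _ _).trans hx.2⟩ _
      ⟨(hcA y hy).1, (min_le_left _ _).trans hy.2⟩ (min_le_min_right a h)).1
  have hl1 : ∀ x y : ℝ, x ≤ y → hat δ (max a (min y T)) ≤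
      hat δ (max a (min x T)) + (max a (min y T) - max a (min x T)) := fun x y h =>
    (p.lip _ ⟨ha.trans (hc1 x).1, (hc1 x).2.trans hT.2⟩ _
      ⟨ha.trans (hc1 y).1, (hc1 y).2.trans hT.2⟩ (max_le_max_left a (min_le_min_right T h))).1
  have hl2 : ∀ x y : ℝ, x ≤ y → hat δ (max T (min x b)) ≤
      hat δ (max T (min y b)) + (max T (min y b) - max T (min x b)) := fun x y h =>
    (p.lip _ ⟨hT.1.trans (hc2 x).1, (hc2 x).2.trans hb⟩ _
      ⟨hT.1.trans (hc2 y).1, (hc2 y).2.trans hb⟩ (max_le_max_left T (min_le_min_right b h))).2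
  have hlE : ∀ x ∈ Icc (0 : ℝ) 1, ∀ y ∈ Icc (0 : ℝ) 1, x ≤ y →
      hat δ (max x b) ≤ hat δ (max y b) + (max y b - max x b) := fun x hx y hy h =>
    (p.lip _ ⟨hb0.trans (hcE x hx).1, (hcE x hx).2⟩ _
      ⟨hb0.trans (hcE y hy).1, (hcE y hy).2⟩ (max_le_max_right b h)).2
  have hm1 : ∀ x y : ℝ, x ≤ y → max a (min x T) ≤ max a (min y T) := fun x y h =>
    max_le_max_left a (min_le_min_right T h)
  have hm2 : ∀ x y : ℝ, x ≤ y → max T (min x b) ≤ max T (min y b) := fun x y h =>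
    max_le_max_left T (min_le_min_right b h)
  have e0 : min 0 a = 0 ∧ max a (min 0 T) = a ∧ max T (min 0 b) = T ∧ max 0 b = b :=
    ⟨min_eq_left ha, by rw [min_eq_left hT.1, max_eq_left ha],
      by rw [min_eq_left hb0, max_eq_left hT.1], max_eq_right hb0⟩
  have e1 : min 1 a = a ∧ max a (min 1 T) = T ∧ max T (min 1 b) = b ∧ max 1 b = 1 :=
    ⟨min_eq_right (haT.trans hT.2), by rw [min_eq_right hT.2, max_eq_right haT],
      by rw [min_eq_right hb, max_eq_right hTb], max_eq_left hb⟩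
  refine isCopula_sum_min ?_ ?_ ?_ ?_ ?_ ?_ ?_
  · rw [forall_fin_six]
    refine ⟨?_, ?_, ?_, ?_, ?_, ?_⟩ <;> intro x hx y hy h <;>
      simp only [leftPart, Matrix.cons_val]
    · linarith [hlA x hx y hy h]
    · linarith [hlE x hx y hy h]
    · exact hwA hx hy h
    · linarith [hl2 x y h, hm1 x y h]
    · exact sub_le_sub_left (hw2 hx hy h) _
    · exact sub_le_sub_left (hwE hx hy h) _
  · rw [forall_fin_six]
    refine ⟨?_, ?_, ?_, ?_, ?_, ?_⟩ <;> intro x hx y hy h <;>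
      simp only [rightPart, Matrix.cons_val]
    · linarith [hlA x hx y hy h]
    · linarith [hlE x hx y hy h]
    · linarith [hl1 x y h, hm2 x y h]
    · exact sub_le_sub_left (hwE hx hy h) _
    · exact sub_le_sub_right (hw1 hx hy h) _
    · exact hwA hx hy h
  · rw [forall_fin_six]
    refine ⟨?_, ?_, ?_, ?_, ?_, ?_⟩ <;>
      simp only [leftPart, Matrix.cons_val, e0, p.zero] <;> ring
  · rw [forall_fin_six]
    refine ⟨?_, ?_, ?_, ?_, ?_, ?_⟩ <;>
      simp only [rightPart, Matrix.cons_val, e0, p.zero] <;> ring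
  · rw [forall_fin_six]
    refine ⟨?_, ?_, ?_, ?_, ?_, ?_⟩ <;>
      simp only [leftPart, rightPart, Matrix.cons_val, e1, p.one] <;> linarith
  · intro x _
    simp only [Fin.sum_univ_six, leftPart, Matrix.cons_val]
    linarith [clamp_sum haT hTb x]
  · intro x _
    simp only [Fin.sum_univ_six, rightPart, Matrix.cons_val]
    linarith [clamp_sum haT hTb x]

theorem hasDiagonal_crossingCopula (p : HasPeak δ T) (ha : 0 ≤ a) (haT : a ≤ T) (hTb : T ≤ b)
    (hb : b ≤ 1) (hab : b = a + hat δ T) (hw : hat δ a = hat δ b) :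
    HasDiagonal (crossingCopula (hat δ) T a b) δ := by
  have hT := p.mem
  have hb0 : 0 ≤ b := hT.1.trans hTb
  have hwa := p.nonneg a ⟨ha, haT.trans hT.2⟩
  have hwb := p.nonneg b ⟨hb0, hb⟩
  have haT' := p.le_peak ⟨ha, haT.trans hT.2⟩
  intro x hx
  have hwx := p.nonneg x hx
  have hwxT := p.le_peak hx
  suffices h : crossingCopula (hat δ) T a b x x = x - hat δ x by rw [h, hat, sub_sub_cancel]
  simp only [crossingCopula, Fin.sum_univ_six, leftPart, rightPart, Matrix.cons_val, min_self]
  rcases le_total x a with h1 | h1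
  · rw [min_eq_left h1, min_eq_left (h1.trans haT), max_eq_left h1,
      min_eq_left (h1.trans (haT.trans hTb)), max_eq_left (h1.trans haT),
      max_eq_right (h1.trans (haT.trans hTb)), min_eq_right (by linarith),
      min_eq_left (by linarith), min_eq_left (by linarith), min_eq_left (by linarith)]
    ring
  rw [min_eq_right h1]
  have hax := p.lip a ⟨ha, haT.trans hT.2⟩ x hx h1
  rcases le_total x T with h2 | h2
  · have hTx := p.lip x hx T hT h2
    have hwax := p.mono ⟨ha, haT⟩ ⟨hx.1, h2⟩ h1
    rw [min_eq_left h2, max_eq_right h1, min_eq_left (h2.trans hTb), max_eq_left h2,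
      max_eq_right (h2.trans hTb), min_eq_right (by linarith),
      min_eq_right (by linarith), min_eq_left (by linarith), min_eq_left (by linarith)]
    ring
  rw [min_eq_right h2, max_eq_right haT]
  rcases le_total x b with h3 | h3
  · have hwxb := p.anti ⟨h2, hx.2⟩ ⟨hTb, hb⟩ h3
    have hTx := p.lip T hT x hx h2
    rw [min_eq_left h3, max_eq_right h2, max_eq_right h3, min_eq_right (by linarith),
      min_eq_right (by linarith [p.lip x hx b ⟨hb0, hb⟩ h3]), min_eq_left (by linarith),
      min_eq_left (by linarith)]
    linarith
  · have hwxb := p.anti ⟨hTb, hb⟩ ⟨h2, hx.2⟩ h3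
    rw [min_eq_right h3, max_eq_right hTb, max_eq_left h3, min_eq_left (by linarith),
      min_eq_right (by linarith), min_eq_left (by linarith), min_eq_left (by linarith)]
    linarith

/-- Here `C a b = a`, while `C b a` falls short of `a` by exactly the mass `hat δ a` of part 5. -/
theorem crossingCopula_sub (p : HasPeak δ T) (ha : 0 ≤ a) (haT : a ≤ T) (hTb : T ≤ b)
    (hab : b = a + hat δ T) (hw : hat δ a = hat δ b) :
    crossingCopula (hat δ) T a b a b - crossingCopula (hat δ) T a b b a = hat δ a := by
  have hT := p.mem
  have hwa := p.nonneg a ⟨ha, haT.trans hT.2⟩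
  have haT' := p.le_peak ⟨ha, haT.trans hT.2⟩
  simp only [crossingCopula, Fin.sum_univ_six, leftPart, rightPart, Matrix.cons_val, min_self,
    max_self, min_eq_left haT, min_eq_left (haT.trans hTb), max_eq_left haT,
    max_eq_right (haT.trans hTb), min_eq_right (haT.trans hTb), min_eq_right hTb,
    max_eq_right haT, max_eq_right hTb]
  rw [min_eq_left (by linarith), min_eq_right (by linarith), min_eq_left (by linarith),
    min_eq_left (by linarith), min_eq_right (by linarith), min_eq_right (by linarith),
    min_eq_right (by linarith)]
  ring

end

/-! ### The upper bound for the asymmetry -/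

/-- Moving from `(x, y)` to `(t, t)` and to `(x, 1)` gives `C x y ≤ min x (y - hat δ t)`. Comparing
`(y, x)` with `(x, x)` and `(y, y)` gives `C y x ≥ x - min (hat δ x) (hat δ y)`. -/
theorem _root_.DiagCopula.IsCopula.sub_swap_le {C : ℝ → ℝ → ℝ} (hC : IsCopula C)
    (hd : HasDiagonal C δ) {x y t : ℝ} (hx : x ∈ Icc (0 : ℝ) 1) (hy : y ∈ Icc (0 : ℝ) 1)
    (ht : t ∈ Icc x y) :
    C x y - C y x ≤ min (hat δ x) (hat δ y) - max 0 (hat δ t - (y - x)) := by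
  have hxy := ht.1.trans ht.2
  have htI : t ∈ Icc (0 : ℝ) 1 := ⟨hx.1.trans ht.1, ht.2.trans hy.2⟩
  have h1 : C x y ≤ x := (hC.right_le hx hy unit_one_mem hy.2).1.trans (hC.marginals x hx).1.le
  have h2 := (hC.left_le hx htI hy ht.1).1
  have h3 := (hC.right_le htI htI hy ht.2).2
  have h4 := (hC.left_le hx hy hx hxy).1
  have h5 := (hC.right_le hy hx hy hxy).2
  rw [hd t htI] at h3
  rw [hd x hx] at h4
  rw [hd y hy] at h5
  have e : ∀ z, δ z = z - hat δ z := fun z => (sub_sub_cancel z (δ z)).symm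
  rw [e] at h3 h4 h5
  rcases min_choice (hat δ x) (hat δ y) with e1 | e1 <;>
    rcases max_choice 0 (hat δ t - (y - x)) with e2 | e2 <;> rw [e1, e2] <;> linarith

theorem IsCrossing.sub_swap_le (p : HasPeak δ T) {a : ℝ} (c : IsCrossing δ T a)
    {C : ℝ → ℝ → ℝ} (hC : IsCopula C) (hd : HasDiagonal C δ) {x y : ℝ}
    (hx : x ∈ Icc (0 : ℝ) 1) (hy : y ∈ Icc (0 : ℝ) 1) (hxy : x ≤ y) :
    C x y - C y x ≤ hat δ a := by
  have h0 := p.peak_nonneg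
  have h1 := p.add_peak_le_one
  have h2 := p.peak_le
  have hT := p.mem
  have ha := c.mem
  have heq := c.eq p
  have haI : a ∈ Icc (0 : ℝ) 1 := ⟨by linarith [ha.1], ha.2.trans hT.2⟩
  have hbI : a + hat δ T ∈ Icc (0 : ℝ) 1 := ⟨by linarith [haI.1], by linarith [ha.2]⟩
  have key : ∀ t ∈ Icc x y, C x y - C y x ≤ hat δ x ∧ C x y - C y x ≤ hat δ y ∧
      C x y - C y x ≤ hat δ x - (hat δ t - (y - x)) ∧
      C x y - C y x ≤ hat δ y - (hat δ t - (y - x)) := fun t ht => by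
    have h3 := hC.sub_swap_le hd hx hy ht
    have h4 := min_le_left (hat δ x) (hat δ y)
    have h5 := min_le_right (hat δ x) (hat δ y)
    have h6 := le_max_left 0 (hat δ t - (y - x))
    have h7 := le_max_right 0 (hat δ t - (y - x))
    refine ⟨?_, ?_, ?_, ?_⟩ <;> linarith
  obtain ⟨k1, k2, -, k4⟩ := key x ⟨le_rfl, hxy⟩
  obtain ⟨-, -, k5, -⟩ := key y ⟨hxy, le_rfl⟩
  rcases le_total x a with hxa | hxa
  · exact k1.trans (p.mono ⟨hx.1, hxa.trans ha.2⟩ ⟨haI.1, ha.2⟩ hxa)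
  rcases le_total (a + hat δ T) y with hya | hya
  · rw [heq]
    exact k2.trans (p.anti ⟨by linarith [ha.1], hbI.2⟩ ⟨by linarith [ha.1], hy.2⟩ hya)
  -- Now `a ≤ x ≤ y ≤ a + hat δ T`. With `t` the point of `[x, y]` nearest to `T` (`y`, `T` or `x`
  -- in the three cases), Lipschitz steps from `a` or `a + hat δ T` and from the peak close the
  -- estimate.
  have h3 := (p.lip a haI x hx hxa).1
  have h4 := (p.lip y hy _ hbI hya).2
  rcases le_total y T with hyT | hyT
  · have := (p.lip y hy T hT hyT).1
    linarith [ha.1]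
  rcases le_total x T with hxT | hxT
  · obtain ⟨-, -, k6, k7⟩ := key T ⟨hxT, hyT⟩
    linarith
  · have := (p.lip T hT x hx hxT).2
    linarith [ha.2]

theorem IsCrossing.abs_sub_swap_le (p : HasPeak δ T) {a : ℝ} (c : IsCrossing δ T a)
    {C : ℝ → ℝ → ℝ} (hC : IsCopula C) (hd : HasDiagonal C δ) {x y : ℝ}
    (hx : x ∈ Icc (0 : ℝ) 1) (hy : y ∈ Icc (0 : ℝ) 1) : |C x y - C y x| ≤ hat δ a := by
  rcases le_total x y with h | h
  · exact abs_sub_le_iff.2 ⟨c.sub_swap_le p hC hd hx hy h, c.sub_swap_le p hC.swap hd hx hy h⟩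
  · exact abs_sub_le_iff.2 ⟨c.sub_swap_le p hC.swap hd hy hx h, c.sub_swap_le p hC hd hy hx h⟩

theorem IsCrossing.asymmetry_le (p : HasPeak δ T) {a : ℝ} (c : IsCrossing δ T a)
    {C : ℝ → ℝ → ℝ} (hC : IsCopula C) (hd : HasDiagonal C δ) : asymmetry C ≤ hat δ a := by
  refine csSup_le ⟨_, 0, unit_zero_mem, 0, unit_zero_mem, rfl⟩ ?_
  rintro r ⟨x, hx, y, hy, rfl⟩
  exact c.abs_sub_swap_le p hC hd hx hy

theorem IsCrossing.maxAsymmetry_eq (p : HasPeak δ T) {a : ℝ} (c : IsCrossing δ T a) :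
    maxAsymmetry δ = hat δ a := by
  have h1 := p.add_peak_le_one
  have h2 := p.peak_le
  have hT := p.mem
  have ha := c.mem
  have ha0 : 0 ≤ a := by linarith [ha.1]
  have hTb : T ≤ a + hat δ T := by linarith [ha.1]
  have hb : a + hat δ T ≤ 1 := by linarith [ha.2]
  have hC := p.isCopula_crossingCopula ha0 ha.2 hTb hb rfl (c.eq p)
  have hd := p.hasDiagonal_crossingCopula ha0 ha.2 hTb hb rfl (c.eq p)
  have hsub := p.crossingCopula_sub ha0 ha.2 hTb rfl (c.eq p)
  refine le_antisymm (csSup_le ⟨_, _, hC, hd, rfl⟩ ?_) ?_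
  · rintro r ⟨C, hC, hd, rfl⟩
    exact c.asymmetry_le p hC hd
  · refine le_trans ?_ (le_csSup (a := asymmetry (crossingCopula (hat δ) T a (a + hat δ T)))
      ⟨hat δ a, ?_⟩ ⟨_, hC, hd, rfl⟩)
    · refine (le_abs_self _).trans (hsub ▸ le_csSup ⟨hat δ a, ?_⟩
        ⟨a, ⟨ha0, ha.2.trans hT.2⟩, a + hat δ T, ⟨hT.1.trans hTb, hb⟩, rfl⟩)
      rintro r ⟨x, hx, y, hy, rfl⟩
      exact c.abs_sub_swap_le p hC hd hx hy
    · rintro r ⟨C, hC, hd, rfl⟩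
      exact c.asymmetry_le p hC hd

end HasPeak

end DiagCopula

theorem mainTheorem8 (δ : ℝ → ℝ) (hδ : DiagCopula.IsDiagonalSection δ)
    (hsimple : DiagCopula.IsSimple δ) :
    (∃! x₀ : ℝ, x₀ ∈ Set.Icc (0 : ℝ) 1 ∧ MonotoneOn (DiagCopula.hat δ) (Set.Icc 0 x₀) ∧
      (x₀, DiagCopula.gU δ x₀) ∈ DiagCopula.H δ) ∧
    ∀ x₀ : ℝ, x₀ ∈ Set.Icc (0 : ℝ) 1 → MonotoneOn (DiagCopula.hat δ) (Set.Icc 0 x₀) →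
      (x₀, DiagCopula.gU δ x₀) ∈ DiagCopula.H δ →
      DiagCopula.maxAsymmetry δ = DiagCopula.hat δ x₀ ∧
      DiagCopula.hat δ x₀ = DiagCopula.hat δ (DiagCopula.gU δ x₀) := by
  obtain ⟨T, p⟩ := hδ.exists_hasPeak hsimple
  obtain ⟨a, c⟩ := p.exists_crossing
  have huniq : ∀ x₀ : ℝ, x₀ ∈ Set.Icc (0 : ℝ) 1 →
      MonotoneOn (DiagCopula.hat δ) (Set.Icc 0 x₀) →
      (x₀, DiagCopula.gU δ x₀) ∈ DiagCopula.H δ → x₀ = a := fun x₀ hx hmono hH =>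
    c.eq_of_mem_H p ⟨hx.1, p.le_of_monotoneOn hx hmono⟩ hH
  have ha0 : 0 ≤ a := by linarith [c.mem.1, p.peak_le]
  refine ⟨⟨a, ⟨⟨ha0, c.mem.2.trans p.mem.2⟩, p.mono.mono (Icc_subset_Icc_right c.mem.2),
    c.mem_H p⟩, fun x₀ hx => huniq x₀ hx.1 hx.2.1 hx.2.2⟩, fun x₀ hx hmono hH => ?_⟩
  obtain rfl := huniq x₀ hx hmono hH
  rw [p.gU_eq c.mem]
  exact ⟨c.maxAsymmetry_eq p, c.eq p⟩
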